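/- For $\tau$ in the upper half-plane $\mathfrak H$ let $q=e^{2\pi i\tau}$, let $'$ denote $(2\pi i)^{-1}d/d\tau$, let $\eta(\tau)=q^{1/24}\prod_{m\ge1}(1-q^m)$ and $E_2(\tau)=1-24\sum_{m\ge1}\bigl(\sum_{d\mid m}d\bigr)q^m$. Put $$E_{2A}(\tau)=\frac{E_2(\tau)+2E_2(2\tau)}{3},\qquad \Delta_{2A}(\tau)=\eta(\tau)^8\eta(2\tau)^8,$$ $$C(\tau)=2E_2(2\tau)-E_2(\tau),\qquad D(\tau)=\frac{\eta(2\tau)^{16}}{\eta(\tau)^8},\qquad G(\tau)=C(\tau)^2-128D(\tau).$$ A quasimodular form of weight $w$ on $\Gamma_0(2)$ is an element of degree $w$ of the graded ring $\mathbb C[E_2,C,D]$, in which $E_2,C,D$ have degrees $2,2,4$. Define polynomials $P_n,Q_n\in\mathbb Q[x]$ by $P_0=1$, $P_1=x$, $Q_0=0$, $Q_1=1$ and, for $n\ge1$, $$P_{n+1}=xP_n+\lambda_nP_{n-1},\qquad Q_{n+1}=xQ_n+\lambda_nQ_{n-1},\qquad \lambda_n=4\,\frac{(4n+1)(4n+3)}{n(n+1)}.$$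 Theorem. Let $n\ge0$ be an integer, let $k=4n+3$, and let $\sqrt{\Delta_{2A}}$ be any function on $\mathfrak H$ whose square is $\Delta_{2A}$. Then the function $$\sqrt{\Delta_{2A}}^{\,n}\,P_n\!\left(\frac{G}{\sqrt{\Delta_{2A}}}\right)\frac{C'}{24}-\sqrt{\Delta_{2A}}^{\,n+1}\,Q_n\!\left(\frac{G}{\sqrt{\Delta_{2A}}}\right)$$ is a quasimodular form of weight $k+1$ on $\Gamma_0(2)$; it lies in $\mathbb Q[E_2,C,D]$, and is indeed the value at $(E_2,C,D)$ of a polynomial with rational coefficients that is homogeneous of degree $k+1$ for the degrees $2,2,4$. It is holomorphic on $\mathfrak H$ and solves there the differential equation $$(\#)_k\qquad f''-\frac{k+1}{4}\,E_{2A}\,f'+\frac{k(k+1)}{8}\,E_{2A}'\,f=0 .$$ -/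

import Mathlib

open UpperHalfPlane

noncomputable section

namespace QuasiGamma02

/-- The point `2τ` of the upper half-plane. -/
def double (τ : ℍ) : ℍ := ⟨2 * (τ : ℂ), by simpa using τ.im_pos⟩

/-- The derivation `f' = (2πi)⁻¹ df/dτ` on functions on the upper half-plane. -/
abbrev qderiv (f : ℍ → ℂ) : ℍ → ℂ := Derivative.normalizedDerivOfComplex f

/-- The Eisenstein series `E₂(τ) = 1 - 24 ∑ σ₁(n) qⁿ` of level one. -/
abbrev E2 : ℍ → ℂ := EisensteinSeries.E2

/-- `E_{2A}(τ) = (E₂(τ) + 2 E₂(2τ)) / 3`. -/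
def E2A (τ : ℍ) : ℂ := (E2 τ + 2 * E2 (double τ)) / 3

/-- `Δ_{2A}(τ) = η(τ)⁸ η(2τ)⁸`. -/
def Delta2A (τ : ℍ) : ℂ := ModularForm.eta τ ^ 8 * ModularForm.eta (double τ) ^ 8

/-- The form `C(τ) = 2 E₂(2τ) - E₂(τ)` of weight `2` on `Γ₀(2)`. -/
def formC (τ : ℍ) : ℂ := 2 * E2 (double τ) - E2 τ

/-- The form `D(τ) = η(2τ)¹⁶ / η(τ)⁸` of weight `4` on `Γ₀(2)`. -/
def formD (τ : ℍ) : ℂ := ModularForm.eta (double τ) ^ 16 / ModularForm.eta τ ^ 8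

/-- `G(τ) = C(τ)² - 128 D(τ)`. -/
def formG (τ : ℍ) : ℂ := formC τ ^ 2 - 128 * formD τ

/-- `λ_n = 4 (4n+1)(4n+3) / (n(n+1))`, used only for `n ≥ 1`. -/
def lam (n : ℕ) : ℚ := 4 * (((4 * n + 1) * (4 * n + 3)) / (n * (n + 1)))

/-- `P_0 = 1`, `P_1 = x`, `P_{n+1} = x P_n + λ_n P_{n-1}` for `n ≥ 1`. -/
def P : ℕ → Polynomial ℚ
  | 0 => 1
  | 1 => Polynomial.X
  | n + 2 => Polynomial.X * P (n + 1) + Polynomial.C (lam (n + 1)) * P n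

/-- `Q_0 = 0`, `Q_1 = 1`, `Q_{n+1} = x Q_n + λ_n Q_{n-1}` for `n ≥ 1`. -/
def Q : ℕ → Polynomial ℚ
  | 0 => 0
  | 1 => 1
  | n + 2 => Polynomial.X * Q (n + 1) + Polynomial.C (lam (n + 1)) * Q n

/-- `f` is a polynomial in `E₂, C, D` with coefficients in `K`, homogeneous of degree `w` when
`E₂, C, D` are given the degrees `2, 2, 4`. -/
def IsHomogeneousIn (K : Type) [CommRing K] [Algebra K ℂ] (w : ℕ) (f : ℍ → ℂ) : Prop :=
  ∃ p : MvPolynomial (Fin 3) K, p.IsWeightedHomogeneous ![2, 2, 4] w ∧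
    ∀ τ : ℍ, f τ = MvPolynomial.aeval ![E2 τ, formC τ, formD τ] p

/-- A quasimodular form of weight `w` on `Γ₀(2)`: an element of degree `w` of the graded ring
`ℂ[E₂, C, D]`. -/
def IsQuasimodularForm (w : ℕ) (f : ℍ → ℂ) : Prop := IsHomogeneousIn ℂ w f

/-- `f` is a holomorphic solution on the upper half-plane of the differential equation
`f'' - ((k+1)/4) E_{2A} f' + (k(k+1)/8) E_{2A}' f = 0`. -/
def IsSolution (k : ℕ) (f : ℍ → ℂ) : Prop :=
  MDifferentiable (modelWithCornersSelf ℂ ℂ) (modelWithCornersSelf ℂ ℂ) f ∧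
  ∀ τ : ℍ, qderiv (qderiv f) τ - ((k : ℂ) + 1) / 4 * E2A τ * qderiv f τ
    + (k : ℂ) * (k + 1) / 8 * qderiv E2A τ * f τ = 0

/-- `sⁿ P_n(G/s) C'/24 - sⁿ⁺¹ Q_n(G/s)`, where `s` stands for a square root of `Δ_{2A}`. -/
def solutionForm (s : ℍ → ℂ) (n : ℕ) (τ : ℍ) : ℂ :=
  s τ ^ n * Polynomial.aeval (formG τ / s τ) (P n) * (qderiv formC τ / 24)
    - s τ ^ (n + 1) * Polynomial.aeval (formG τ / s τ) (Q n)

end QuasiGamma02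

end

noncomputable section

namespace QuasiGamma02

open Complex Filter Function Metric
open scoped Real Topology Manifold MatrixGroups ModularForm

local notation "𝕢" => Periodic.qParam

/-! Write E for E_{2A}, Δ for Δ_{2A}, f_n for the function of the theorem. The ring generated by E,
C, G is closed under the derivation: E' = (E² - C²)/8, C' = (EC - G)/4, G' = (EG - C³)/2, and G² =
C⁴ - 256Δ. These reduce to D'/D = (E + C)/2, read off the product for D, and three identities in
weight four (`qderiv_E2A`, `formC_sq`, `qderiv_formC`). Each of the three concerns an eigenvector of
the Fricke involution vanishing to order two at i∞; its quotient by D is then a modular function on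
Γ₀(2) without poles that vanishes at i∞, hence zero.

The rest is algebra in this differential ring. The operator R_κ f = (κ+2)Gf - 8C(f' - κEf/8) takes
solutions of (#)_κ to solutions of (#)_{κ+4} (`SolvesWith.raise`), and R_{κ+4}R_κ f = (2κ+10)G·R_κ f
+ 256(κ+2)(κ+4)Δf (`raise_raise`). With κ = 4n+3 and R_κ f_n = (8n+8)f_{n+1}, this is exactly
f_{n+2} = G f_{n+1} + λ_{n+1}Δ f_n, the recursion of P_n and Q_n after homogenising. So all f_n
arise from f_0 = C'/24 by raising, and the recursion exhibits them as rational polynomials in E₂, C,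
D. -/

/-! ### The normalised derivative -/

/-- `f` is holomorphic on the upper half-plane with `(2πi)⁻¹ df/dτ = f'`. -/
def HasQDeriv (f f' : ℍ → ℂ) : Prop :=
  ∀ τ : ℍ, HasDerivAt (f ∘ ofComplex) (2 * π * Complex.I * f' τ) τ

lemma HasQDeriv.mdifferentiable {f f' : ℍ → ℂ} (h : HasQDeriv f f') : MDiff f :=
  fun τ ↦ mdifferentiableAt_iff.mpr (h τ).differentiableAt

lemma HasQDeriv.qderiv_eq {f f' : ℍ → ℂ} (h : HasQDeriv f f') : qderiv f = f' := by
  ext τ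
  rw [qderiv, Derivative.normalizedDerivOfComplex, (h τ).deriv, inv_mul_cancel_left₀]
  exact two_pi_I_ne_zero

lemma hasQDeriv_qderiv {f : ℍ → ℂ} (h : MDiff f) : HasQDeriv f (qderiv f) := by
  intro τ
  rw [qderiv, Derivative.normalizedDerivOfComplex, mul_inv_cancel_left₀ two_pi_I_ne_zero]
  exact (mdifferentiableAt_iff.mp (h τ)).hasDerivAt

lemma HasQDeriv.congr {f f' g' : ℍ → ℂ} (h : HasQDeriv f f') (hg : ∀ τ, f' τ = g' τ) :
    HasQDeriv f g' := by
  rwa [← funext hg]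

lemma hasQDeriv_const (c : ℂ) : HasQDeriv (fun _ ↦ c) fun _ ↦ 0 := by
  intro τ
  simpa using! hasDerivAt_const (τ : ℂ) c

lemma HasQDeriv.add {f f' g g' : ℍ → ℂ} (hf : HasQDeriv f f') (hg : HasQDeriv g g') :
    HasQDeriv (fun τ ↦ f τ + g τ) fun τ ↦ f' τ + g' τ := by
  intro τ
  convert! (hf τ).add (hg τ) using 1
  ring

lemma HasQDeriv.sub {f f' g g' : ℍ → ℂ} (hf : HasQDeriv f f') (hg : HasQDeriv g g') :
    HasQDeriv (fun τ ↦ f τ - g τ) fun τ ↦ f' τ - g' τ := by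
  intro τ
  convert! (hf τ).sub (hg τ) using 1
  ring

lemma HasQDeriv.mul {f f' g g' : ℍ → ℂ} (hf : HasQDeriv f f') (hg : HasQDeriv g g') :
    HasQDeriv (fun τ ↦ f τ * g τ) fun τ ↦ f' τ * g τ + f τ * g' τ := by
  intro τ
  convert! (hf τ).mul (hg τ) using 1
  simp [ofComplex_apply]
  ring

lemma HasQDeriv.const_mul {f f' : ℍ → ℂ} (c : ℂ) (hf : HasQDeriv f f') :
    HasQDeriv (fun τ ↦ c * f τ) fun τ ↦ c * f' τ := by
  simpa using (hasQDeriv_const c).mul hf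

lemma HasQDeriv.pow {f f' : ℍ → ℂ} (hf : HasQDeriv f f') (n : ℕ) :
    HasQDeriv (fun τ ↦ f τ ^ n) fun τ ↦ n * f τ ^ (n - 1) * f' τ := by
  intro τ
  convert! (hf τ).pow n using 1
  simp [ofComplex_apply]
  ring

/-! ### Functions of `q` -/

lemma qParam_mem_ball {N : ℝ} (hN : 0 < N) (τ : ℍ) : 𝕢 N τ ∈ ball (0 : ℂ) 1 := by
  simpa using Periodic.norm_qParam_lt_one hN τ.im_pos

lemma differentiableAt_of_mem_ball {g : ℂ → ℂ} (hg : DifferentiableOn ℂ g (ball 0 1)) {q : ℂ}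
    (hq : q ∈ ball (0 : ℂ) 1) : DifferentiableAt ℂ g q :=
  (hg q hq).differentiableAt (isOpen_ball.mem_nhds hq)

lemma hasDerivAt_qParam (N : ℝ) (z : ℂ) :
    HasDerivAt (𝕢 N) (2 * π * Complex.I / N * 𝕢 N z) z := by
  have h : HasDerivAt (fun z : ℂ ↦ 2 * π * Complex.I * z / N) (2 * π * Complex.I / N) z := by
    simpa using! ((hasDerivAt_id z).const_mul (2 * π * Complex.I)).div_const (N : ℂ)
  convert! h.cexp using 1
  rw [Periodic.qParam]
  ring

/-- N = 1 serves the cusp i∞; N = 2 serves the cusp 0, whose local parameter is q^{1/2}. -/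
lemma hasQDeriv_comp_qParam {N : ℝ} (hN : 0 < N) {g : ℂ → ℂ}
    (hg : DifferentiableOn ℂ g (ball 0 1)) :
    HasQDeriv (fun τ ↦ g (𝕢 N τ)) fun τ ↦ 𝕢 N τ * deriv g (𝕢 N τ) / N := by
  intro τ
  have h := (differentiableAt_of_mem_ball hg (qParam_mem_ball hN τ)).hasDerivAt.comp (τ : ℂ)
    (hasDerivAt_qParam N τ)
  refine (h.congr_deriv ?_).congr_of_eventuallyEq ?_
  · ring
  · filter_upwards [isOpen_upperHalfPlaneSet.mem_nhds τ.im_pos] with z hz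
    simp [ofComplex_apply_of_im_pos hz]

lemma tendsto_comp_qParam {N : ℝ} (hN : 0 < N) {g : ℂ → ℂ} (hg : ContinuousAt g 0) :
    Tendsto (fun τ : ℍ ↦ g (𝕢 N τ)) atImInfty (𝓝 (g 0)) :=
  hg.tendsto.comp (qParam_tendsto_atImInfty hN)

/-! ### The Euler product and the logarithmic derivative of `η` -/

/-- The Euler product `∏ (1 - qⁿ)`. -/
def eulerProd (q : ℂ) : ℂ := ∏' n : ℕ, (1 - q ^ (n + 1))

lemma differentiableOn_eulerProd : DifferentiableOn ℂ eulerProd (ball 0 1) :=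
  ModularForm.differentiableOn_tprod_one_sub_pow

lemma one_sub_pow_ne_zero {q : ℂ} (hq : q ∈ ball (0 : ℂ) 1) (n : ℕ) : 1 - q ^ (n + 1) ≠ 0 := by
  have hq' : ‖q‖ < 1 := by simpa using hq
  intro h
  have h1 : ‖q ^ (n + 1)‖ = 1 := by rw [← sub_eq_zero.mp h, norm_one]
  rw [norm_pow] at h1
  exact (pow_lt_one₀ (norm_nonneg q) hq' n.succ_ne_zero).ne h1

lemma eulerProd_ne_zero {q : ℂ} (hq : q ∈ ball (0 : ℂ) 1) : eulerProd q ≠ 0 := by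
  have hq' : ‖q‖ < 1 := by simpa using hq
  refine tprod_one_add_ne_zero_of_summable (f := fun n : ℕ ↦ -q ^ (n + 1)) (fun n ↦ ?_) ?_
  · simpa [sub_eq_add_neg] using one_sub_pow_ne_zero hq n
  · simpa using (summable_nat_add_iff 1).mpr (summable_geometric_of_lt_one (norm_nonneg _) hq')

lemma eulerProd_zero : eulerProd 0 = 1 := by
  simp [eulerProd]

lemma deriv_eulerProd_zero : deriv eulerProd 0 = -1 := by
  have h0 : (0 : ℂ) ∈ ball (0 : ℂ) 1 := mem_ball_self one_pos
  -- Only the factor 1 - q has a nonzero logarithmic derivative at q = 0.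
  have hterm (n : ℕ) : logDeriv (fun q : ℂ ↦ 1 - q ^ (n + 1)) 0 = if n = 0 then -1 else 0 := by
    rcases n with _ | n <;> simp [logDeriv_apply]
  have h := logDeriv_tprod_eq_tsum (f := fun (n : ℕ) (q : ℂ) ↦ 1 - q ^ (n + 1)) isOpen_ball h0
    (one_sub_pow_ne_zero h0) (fun _ ↦ by fun_prop) ?_
    ModularForm.multipliableLocallyUniformlyOn_one_sub_pow (eulerProd_ne_zero h0)
  · change logDeriv eulerProd 0 = _ at h
    simp_rw [hterm, tsum_ite_eq] at h
    simpa [logDeriv_apply, eulerProd_zero] using h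
  · simp_rw [hterm]
    exact (hasSum_ite_eq 0 (-1 : ℂ)).summable

lemma eta_eq (τ : ℍ) : ModularForm.eta τ = 𝕢 24 τ * eulerProd (𝕢 1 τ) := rfl

/-- The function `1 + 24 q p'(q) / p(q)`, with `p` the Euler product, whose value at
`q = exp (2πiτ)` is `E₂(τ)`. -/
def e2Disc (q : ℂ) : ℂ := 1 + 24 * (q * deriv eulerProd q / eulerProd q)

lemma differentiableOn_e2Disc : DifferentiableOn ℂ e2Disc (ball 0 1) :=
  (((differentiableOn_id.mul (differentiableOn_eulerProd.deriv isOpen_ball)).div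
    differentiableOn_eulerProd fun _ ↦ eulerProd_ne_zero).const_mul 24).const_add 1

lemma e2Disc_zero : e2Disc 0 = 1 := by simp [e2Disc]

/-- E₂ is (12/πi) times the logarithmic derivative of η, so the Euler product suffices and divisor
sums never enter. -/
lemma E2_eq (τ : ℍ) : E2 τ = e2Disc (𝕢 1 τ) := by
  have hq := qParam_mem_ball one_pos τ
  have hp := eulerProd_ne_zero hq
  have hd := (differentiableAt_of_mem_ball differentiableOn_eulerProd hq).hasDerivAt.comp (τ : ℂ)
    (hasDerivAt_qParam 1 τ)
  have hη := (hasDerivAt_qParam 24 τ).mul hd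
  have h := ModularForm.logDeriv_eta_eq_E2 τ
  have h24 := Periodic.qParam_ne_zero (h := 24) (τ : ℂ)
  have he : deriv ModularForm.eta τ = _ := hη.deriv
  rw [logDeriv_apply, he, eta_eq] at h
  simp only [Function.comp_apply, e2Disc] at h ⊢
  have hpi : (π : ℂ) * Complex.I ≠ 0 := by simp [Real.pi_ne_zero]
  apply mul_left_cancel₀ (div_ne_zero hpi (by norm_num : (12 : ℂ) ≠ 0))
  rw [← h]
  field_simp
  push_cast
  ring

lemma hasDerivAt_e2Disc_zero : HasDerivAt e2Disc (-24) 0 := by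
  have h0 : (0 : ℂ) ∈ ball (0 : ℂ) 1 := mem_ball_self one_pos
  have hp := (differentiableAt_of_mem_ball differentiableOn_eulerProd h0).hasDerivAt
  have hp' := (differentiableAt_of_mem_ball
    (differentiableOn_eulerProd.deriv isOpen_ball) h0).hasDerivAt
  have h := ((((hasDerivAt_id (0 : ℂ)).mul hp').div hp (eulerProd_ne_zero h0)).const_mul
    24).const_add 1
  convert! h using 1
  simp [eulerProd_zero, deriv_eulerProd_zero]

lemma qParam_double (τ : ℍ) : 𝕢 1 (double τ) = 𝕢 1 τ ^ 2 := by
  change 𝕢 1 (2 * (τ : ℂ)) = _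
  simp only [Periodic.qParam, ← Complex.exp_nat_mul]
  congr 1
  push_cast
  ring

lemma sq_mem_ball {q : ℂ} (hq : q ∈ ball (0 : ℂ) 1) : q ^ 2 ∈ ball (0 : ℂ) 1 := by
  have hq' : ‖q‖ < 1 := by simpa using hq
  simpa using pow_lt_one₀ (norm_nonneg q) hq' two_ne_zero

lemma differentiableOn_comp_sq {g : ℂ → ℂ} (hg : DifferentiableOn ℂ g (ball 0 1)) :
    DifferentiableOn ℂ (fun q ↦ g (q ^ 2)) (ball 0 1) :=
  hg.comp (by fun_prop) fun _ ↦ sq_mem_ball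

lemma hasDerivAt_comp_sq_zero {g : ℂ → ℂ} (hg : DifferentiableOn ℂ g (ball 0 1)) :
    HasDerivAt (fun q ↦ g (q ^ 2)) 0 0 := by
  have h0 : (0 : ℂ) ∈ ball (0 : ℂ) 1 := mem_ball_self one_pos
  have h2 : HasDerivAt (fun q : ℂ ↦ q ^ 2) 0 0 := by simpa using hasDerivAt_pow 2 (0 : ℂ)
  have hg' : HasDerivAt g (deriv g 0) ((0 : ℂ) ^ 2) := by
    simpa using (differentiableAt_of_mem_ball hg h0).hasDerivAt
  simpa using! hg'.comp (0 : ℂ) h2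

/-! ### The forms as functions of `q` -/

/-- The function of `q` giving `E_{2A}`. -/
def e2ADisc (q : ℂ) : ℂ := (e2Disc q + 2 * e2Disc (q ^ 2)) / 3

/-- The function of `q` giving `C`. -/
def formCDisc (q : ℂ) : ℂ := 2 * e2Disc (q ^ 2) - e2Disc q

/-- The function of `q` giving `D / q`. -/
def formDDisc (q : ℂ) : ℂ := eulerProd (q ^ 2) ^ 16 / eulerProd q ^ 8

/-- The form `B(τ) = η(τ)¹⁶ / η(2τ)⁸` of weight `4` on `Γ₀(2)`. -/
def formB (τ : ℍ) : ℂ := ModularForm.eta τ ^ 16 / ModularForm.eta (double τ) ^ 8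

/-- The function of `q` giving `B`. -/
def formBDisc (q : ℂ) : ℂ := eulerProd q ^ 16 / eulerProd (q ^ 2) ^ 8

lemma E2A_eq (τ : ℍ) : E2A τ = e2ADisc (𝕢 1 τ) := by
  simp only [E2A, e2ADisc, E2_eq, qParam_double]

lemma formC_eq (τ : ℍ) : formC τ = formCDisc (𝕢 1 τ) := by
  simp only [formC, formCDisc, E2_eq, qParam_double]

lemma qParam_24_pow (τ : ℍ) : 𝕢 24 τ ^ 24 = 𝕢 1 τ := by
  simp only [Periodic.qParam, ← Complex.exp_nat_mul]
  congr 1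
  push_cast
  ring

lemma qParam_24_double (τ : ℍ) : 𝕢 24 (double τ) = 𝕢 24 τ ^ 2 := by
  change 𝕢 24 (2 * (τ : ℂ)) = _
  simp only [Periodic.qParam, ← Complex.exp_nat_mul]
  congr 1
  push_cast
  ring

lemma formD_eq (τ : ℍ) : formD τ = 𝕢 1 τ * formDDisc (𝕢 1 τ) := by
  have h24 := Periodic.qParam_ne_zero (h := 24) (τ : ℂ)
  have hp := eulerProd_ne_zero (qParam_mem_ball one_pos τ)
  rw [formD, formDDisc, eta_eq, eta_eq, qParam_double, qParam_24_double]
  generalize eulerProd (𝕢 1 τ ^ 2) = a, eulerProd (𝕢 1 τ) = b at *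
  rw [← qParam_24_pow]
  field_simp

lemma formB_eq (τ : ℍ) : formB τ = formBDisc (𝕢 1 τ) := by
  have h24 := Periodic.qParam_ne_zero (h := 24) (τ : ℂ)
  have hp := eulerProd_ne_zero (sq_mem_ball (qParam_mem_ball one_pos τ))
  rw [formB, formBDisc, eta_eq, eta_eq, qParam_double, qParam_24_double]
  field_simp

lemma differentiableOn_e2ADisc : DifferentiableOn ℂ e2ADisc (ball 0 1) :=
  (differentiableOn_e2Disc.add
    ((differentiableOn_comp_sq differentiableOn_e2Disc).const_mul 2)).div_const 3

lemma differentiableOn_formCDisc : DifferentiableOn ℂ formCDisc (ball 0 1) :=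
  ((differentiableOn_comp_sq differentiableOn_e2Disc).const_mul 2).sub differentiableOn_e2Disc

lemma differentiableOn_formDDisc : DifferentiableOn ℂ formDDisc (ball 0 1) :=
  ((differentiableOn_comp_sq differentiableOn_eulerProd).pow 16).div
    (differentiableOn_eulerProd.pow 8) fun _ hq ↦ pow_ne_zero _ (eulerProd_ne_zero hq)

lemma differentiableOn_formBDisc : DifferentiableOn ℂ formBDisc (ball 0 1) :=
  (differentiableOn_eulerProd.pow 16).div
    ((differentiableOn_comp_sq differentiableOn_eulerProd).pow 8)
    fun _ hq ↦ pow_ne_zero _ (eulerProd_ne_zero (sq_mem_ball hq))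

lemma formDDisc_ne_zero {q : ℂ} (hq : q ∈ ball (0 : ℂ) 1) : formDDisc q ≠ 0 :=
  div_ne_zero (pow_ne_zero _ (eulerProd_ne_zero (sq_mem_ball hq)))
    (pow_ne_zero _ (eulerProd_ne_zero hq))

lemma formBDisc_ne_zero {q : ℂ} (hq : q ∈ ball (0 : ℂ) 1) : formBDisc q ≠ 0 :=
  div_ne_zero (pow_ne_zero _ (eulerProd_ne_zero hq))
    (pow_ne_zero _ (eulerProd_ne_zero (sq_mem_ball hq)))

lemma hasDerivAt_e2ADisc_zero : HasDerivAt e2ADisc (-8) 0 := by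
  convert! (hasDerivAt_e2Disc_zero.add
    ((hasDerivAt_comp_sq_zero differentiableOn_e2Disc).const_mul 2)).div_const 3 using 1
  norm_num

lemma hasDerivAt_formCDisc_zero : HasDerivAt formCDisc 24 0 := by
  convert! ((hasDerivAt_comp_sq_zero differentiableOn_e2Disc).const_mul 2).sub
    hasDerivAt_e2Disc_zero using 1
  norm_num

lemma hasDerivAt_formBDisc_zero : HasDerivAt formBDisc (-16) 0 := by
  have h0 : (0 : ℂ) ∈ ball (0 : ℂ) 1 := mem_ball_self one_pos
  have hp := (differentiableAt_of_mem_ball differentiableOn_eulerProd h0).hasDerivAt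
  convert! (hp.pow 16).div ((hasDerivAt_comp_sq_zero differentiableOn_eulerProd).pow 8)
    (by simp [eulerProd_zero]) using 1
  simp [eulerProd_zero, deriv_eulerProd_zero]

lemma e2ADisc_zero : e2ADisc 0 = 1 := by
  simp [e2ADisc, e2Disc_zero]
  norm_num

lemma formCDisc_zero : formCDisc 0 = 1 := by
  simp [formCDisc, e2Disc_zero]
  norm_num

lemma formDDisc_zero : formDDisc 0 = 1 := by simp [formDDisc, eulerProd_zero]

lemma formBDisc_zero : formBDisc 0 = 1 := by simp [formBDisc, eulerProd_zero]

lemma mdifferentiable_E2A : MDiff E2A := by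
  rw [funext E2A_eq]
  exact (hasQDeriv_comp_qParam one_pos differentiableOn_e2ADisc).mdifferentiable

lemma mdifferentiable_formC : MDiff formC := by
  rw [funext formC_eq]
  exact (hasQDeriv_comp_qParam one_pos differentiableOn_formCDisc).mdifferentiable

lemma qderiv_E2A_eq (τ : ℍ) : qderiv E2A τ = 𝕢 1 τ * deriv e2ADisc (𝕢 1 τ) := by
  rw [funext E2A_eq, (hasQDeriv_comp_qParam one_pos differentiableOn_e2ADisc).qderiv_eq]
  simp

lemma qderiv_formC_eq (τ : ℍ) : qderiv formC τ = 𝕢 1 τ * deriv formCDisc (𝕢 1 τ) := by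
  rw [funext formC_eq, (hasQDeriv_comp_qParam one_pos differentiableOn_formCDisc).qderiv_eq]
  simp

lemma eta_ne_zero (τ : ℍ) : ModularForm.eta τ ≠ 0 := ModularForm.eta_ne_zero τ.im_pos

lemma formD_ne_zero (τ : ℍ) : formD τ ≠ 0 :=
  div_ne_zero (pow_ne_zero _ (eta_ne_zero _)) (pow_ne_zero _ (eta_ne_zero _))

lemma formB_ne_zero (τ : ℍ) : formB τ ≠ 0 :=
  div_ne_zero (pow_ne_zero _ (eta_ne_zero _)) (pow_ne_zero _ (eta_ne_zero _))

lemma Delta2A_eq (τ : ℍ) : Delta2A τ = formD τ * formB τ := by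
  have h1 := eta_ne_zero τ
  have h2 := eta_ne_zero (double τ)
  rw [Delta2A, formD, formB]
  field_simp

lemma hasDerivAt_eulerProd {q : ℂ} (hq : q ∈ ball (0 : ℂ) 1) :
    HasDerivAt eulerProd (deriv eulerProd q) q :=
  (differentiableAt_of_mem_ball differentiableOn_eulerProd hq).hasDerivAt

lemma hasQDeriv_formD : HasQDeriv formD fun τ ↦ formD τ * ((E2A τ + formC τ) / 2) := by
  have hd : DifferentiableOn ℂ (fun q ↦ q * formDDisc q) (ball 0 1) :=
    differentiableOn_id.mul differentiableOn_formDDisc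
  rw [funext formD_eq]
  refine (hasQDeriv_comp_qParam one_pos hd).congr fun τ ↦ ?_
  beta_reduce
  rw [E2A_eq, formC_eq]
  have hq := qParam_mem_ball one_pos τ
  have hq2 := sq_mem_ball hq
  generalize 𝕢 1 τ = q at hq hq2 ⊢
  have hp := eulerProd_ne_zero hq
  have hp2 := eulerProd_ne_zero hq2
  have h := (hasDerivAt_id q).mul ((((hasDerivAt_eulerProd hq2).comp q (hasDerivAt_pow 2 q)).pow
    16).div ((hasDerivAt_eulerProd hq).pow 8) (pow_ne_zero _ hp))
  have h' : deriv (fun q ↦ q * formDDisc q) q = _ := h.deriv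
  rw [h']
  simp only [Function.comp_apply, Pi.pow_apply, id, e2ADisc, formCDisc, formDDisc, e2Disc,
    Pi.div_apply]
  field_simp
  push_cast
  ring

/-! ### Modular functions of level one and of level two -/

open ModularGroup in
lemma eq_zero_of_levelOne_weight_zero {f : ℍ → ℂ} (hf : MDiff f)
    (hT : ∀ τ : ℍ, f ((1 : ℝ) +ᵥ τ) = f τ) (hS : ∀ τ : ℍ, f (S • τ) = f τ)
    (h0 : Tendsto f atImInfty (𝓝 0)) : f = 0 := by
  have hS' : f ∣[(0 : ℤ)] S = f := by
    ext τ
    rw [ModularForm.SL_slash_apply, hS]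
    simp
  have hT' : f ∣[(0 : ℤ)] T = f := by
    ext τ
    rw [ModularForm.SL_slash_apply, modular_T_smul, hT]
    simp
  let F : ModularForm 𝒮ℒ 0 :=
    { toFun := f
      slash_action_eq' := by
        rintro A ⟨A, rfl⟩
        exact SlashInvariantForm.slash_action_generators_SL2Z hS' hT' A
      holo' := hf
      bdd_at_cusps' := fun hc ↦ by
        rw [Subgroup.IsArithmetic.isCusp_iff_isCusp_SL2Z] at hc
        rw [OnePoint.isBoundedAt_iff_forall_SL2Z hc]
        intro γ _
        rw [SlashInvariantForm.slash_action_generators_SL2Z hS' hT']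
        exact IsZeroAtImInfty.isBoundedAtImInfty h0 }
  obtain ⟨c, hc⟩ := ModularFormClass.levelOne_weight_zero_const F
  have hc' : f = Function.const ℍ c := hc
  rw [hc'] at h0 ⊢
  rw [tendsto_nhds_unique tendsto_const_nhds h0]
  rfl

/-- The Fricke involution `τ ↦ -1 / (2τ)`. -/
def fricke (τ : ℍ) : ℍ := ModularGroup.S • double τ

/-- The point `τ / 2` of the upper half-plane. -/
def half (τ : ℍ) : ℍ := ⟨(τ : ℂ) / 2, by simpa using τ.im_pos⟩

lemma coe_double (τ : ℍ) : (double τ : ℂ) = 2 * τ := rfl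

lemma coe_half (τ : ℍ) : (half τ : ℂ) = τ / 2 := rfl

lemma coe_S_smul (τ : ℍ) : ((ModularGroup.S • τ : ℍ) : ℂ) = -(τ : ℂ)⁻¹ := by
  rw [modular_S_smul]
  exact inv_neg

lemma coe_fricke (τ : ℍ) : (fricke τ : ℂ) = -(2 * (τ : ℂ))⁻¹ := by
  rw [fricke, coe_S_smul, coe_double]

lemma double_fricke (τ : ℍ) : double (fricke τ) = ModularGroup.S • τ := by
  ext
  rw [coe_double, coe_fricke, coe_S_smul]
  field_simp

lemma fricke_half (τ : ℍ) : fricke (half τ) = ModularGroup.S • τ := by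
  rw [fricke]
  congr 1
  ext
  rw [coe_double, coe_half]
  ring

lemma qParam_half (τ : ℍ) : 𝕢 1 (half τ) = 𝕢 2 τ := by
  simp only [coe_half, Periodic.qParam]
  congr 1
  push_cast
  ring

lemma qParam_one_vadd (τ : ℍ) : 𝕢 1 ((1 : ℝ) +ᵥ τ : ℍ) = 𝕢 1 τ := by
  simp only [Periodic.qParam, coe_vadd]
  rw [← Complex.exp_periodic (2 * π * Complex.I * τ / (1 : ℝ))]
  congr 1
  push_cast
  ring

lemma qParam_two_vadd (τ : ℍ) : 𝕢 2 ((1 : ℝ) +ᵥ τ : ℍ) = -𝕢 2 τ := by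
  simp only [Periodic.qParam, coe_vadd]
  rw [← Complex.exp_antiperiodic]
  congr 1
  push_cast
  ring

lemma vadd_S_vadd_S (τ : ℍ) :
    (1 : ℝ) +ᵥ (ModularGroup.S • ((1 : ℝ) +ᵥ (ModularGroup.S • τ))) =
      ModularGroup.S • ((-1 : ℝ) +ᵥ τ) := by
  have h1 : (τ : ℂ) - 1 ≠ 0 := by
    have := ne_zero ((-1 : ℝ) +ᵥ τ)
    rw [coe_vadd] at this
    push_cast at this
    rwa [neg_add_eq_sub] at this
  have h0 := ne_zero τ
  ext
  rw [coe_vadd, coe_S_smul, coe_S_smul, coe_vadd, coe_vadd, coe_S_smul]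
  push_cast
  have h2 : (1 : ℂ) + -(τ : ℂ)⁻¹ = (τ - 1) / τ := by field_simp; ring
  have h3 : (-1 : ℂ) + τ = τ - 1 := by ring
  rw [h2, h3]
  field_simp
  ring

/-- A function of weight `0` with expansion `φ(q)` at `i∞` and `ψ(q^{1/2})` at `0`, invariant
under `Γ₀(2)` and vanishing at `i∞`, is zero. -/
lemma eq_zero_of_levelTwo_weight_zero {φ ψ : ℂ → ℂ} (hφ : DifferentiableOn ℂ φ (ball 0 1))
    (hψ : DifferentiableOn ℂ ψ (ball 0 1)) (hφ0 : φ 0 = 0)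
    (hS : ∀ τ : ℍ, φ (𝕢 1 (ModularGroup.S • τ : ℍ)) = ψ (𝕢 2 τ)) (τ : ℍ) :
    φ (𝕢 1 τ) = 0 := by
  have h0 : ball (0 : ℂ) 1 ∈ 𝓝 0 := ball_mem_nhds 0 one_pos
  have hψ' : DifferentiableOn ℂ (fun q ↦ ψ (-q)) (ball 0 1) :=
    hψ.comp (by fun_prop) fun q hq ↦ by simpa using hq
  have mφ := (hasQDeriv_comp_qParam one_pos hφ).mdifferentiable
  have mψ := (hasQDeriv_comp_qParam two_pos hψ).mdifferentiable
  have mψ' := (hasQDeriv_comp_qParam two_pos hψ').mdifferentiable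
  have hSS (τ : ℍ) : ModularGroup.S • ModularGroup.S • τ = τ := by
    ext
    rw [coe_S_smul, coe_S_smul]
    simp
  have hneg (τ : ℍ) : 𝕢 2 ((-1 : ℝ) +ᵥ τ : ℍ) = -𝕢 2 τ := by
    rw [← neg_neg (𝕢 2 ((-1 : ℝ) +ᵥ τ : ℍ)), ← qParam_two_vadd, vadd_vadd]
    simp
  -- The norm down to level one, a product over the three cosets of Γ₀(2): T swaps the last two
  -- factors, S swaps the first two and fixes the third.
  have hprod : ((fun τ : ℍ ↦ φ (𝕢 1 τ)) * fun τ : ℍ ↦ ψ (𝕢 2 τ)) *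
      (fun τ : ℍ ↦ ψ (-𝕢 2 τ)) = 0 := by
    refine eq_zero_of_levelOne_weight_zero ((mφ.mul mψ).mul mψ') (fun τ ↦ ?_) (fun τ ↦ ?_) ?_
    · simp only [Pi.mul_apply, qParam_one_vadd, qParam_two_vadd, neg_neg]
      ring
    · have h1 : ψ (𝕢 2 (ModularGroup.S • τ : ℍ)) = φ (𝕢 1 τ) := by rw [← hS, hSS]
      have h2 : ψ (-𝕢 2 (ModularGroup.S • τ : ℍ)) = ψ (-𝕢 2 τ) := by
        rw [← qParam_two_vadd, ← hS, ← qParam_one_vadd, vadd_S_vadd_S, hS, hneg]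
      simp only [Pi.mul_apply, hS, h1, h2]
      ring
    · have := ((tendsto_comp_qParam one_pos (hφ.continuousOn.continuousAt h0)).mul
        (tendsto_comp_qParam two_pos (hψ.continuousOn.continuousAt h0))).mul
        (tendsto_comp_qParam two_pos (hψ'.continuousOn.continuousAt h0))
      simpa [hφ0] using! this
  -- A vanishing product of holomorphic functions on ℍ has a vanishing factor, and each factor is a
  -- translate of the first.
  rw [mul_eq_zero_iff (mφ.mul mψ) mψ', mul_eq_zero_iff mφ mψ] at hprod
  obtain (h | h) | h := hprod
  · exact congrFun h τ
  · have := congrFun h (ModularGroup.S • τ)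
    simpa only [← hS, hSS] using! this
  · have := congrFun h ((1 : ℝ) +ᵥ (ModularGroup.S • τ))
    simpa only [qParam_two_vadd, neg_neg, ← hS, hSS] using! this

/-! ### The Fricke involution -/

lemma E2_S_smul (τ : ℍ) :
    E2 (ModularGroup.S • τ) = τ ^ 2 * E2 τ + 6 * τ / (π * Complex.I) := by
  have h := congrFun (EisensteinSeries.E2_slash_action ModularGroup.S) τ
  rw [ModularForm.SL_slash_apply] at h
  simp only [ModularGroup.denom_S, Pi.sub_apply, Pi.smul_apply, smul_eq_mul,
    EisensteinSeries.D2_S, riemannZeta_two] at h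
  have h0 := ne_zero τ
  have hpi : (π : ℂ) ≠ 0 := by simp [Real.pi_ne_zero]
  have hI := Complex.I_ne_zero
  rw [zpow_neg, mul_inv_eq_iff_eq_mul₀ (zpow_ne_zero _ h0)] at h
  refine h.trans ?_
  rw [zpow_ofNat]
  field_simp
  linear_combination (-6) * Complex.I_sq

/-- The eighth power removes both the branch of the square root and the root of unity. -/
lemma eta_S_smul_pow (τ : ℍ) :
    ModularForm.eta (ModularGroup.S • τ : ℍ) ^ 8 = τ ^ 4 * ModularForm.eta τ ^ 8 := by
  have hsqrt {z : ℂ} (hz : z ≠ 0) : sqrt z ^ 8 = z ^ 4 := by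
    rw [sqrt_eq_exp hz, ← Complex.exp_nat_mul, show ((8 : ℕ) : ℂ) * (log z / 2) = (4 : ℕ) * log z by
      push_cast; ring, Complex.exp_nat_mul, exp_log hz]
  have h : ModularForm.eta (-(τ : ℂ)⁻¹) = (sqrt Complex.I)⁻¹ * (sqrt τ * ModularForm.eta τ) := by
    simpa [neg_div] using ModularForm.eta_comp_eq_csqrt_I_inv τ.2
  rw [coe_S_smul, h, mul_pow, mul_pow, inv_pow, hsqrt Complex.I_ne_zero, hsqrt (ne_zero τ)]
  simp

lemma E2A_fricke (τ : ℍ) :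
    E2A (fricke τ) = 2 * τ ^ 2 * E2A τ + 8 * τ / (π * Complex.I) := by
  rw [E2A, double_fricke, fricke, E2_S_smul, E2_S_smul, coe_double, E2A]
  ring

lemma formC_fricke (τ : ℍ) : formC (fricke τ) = -2 * τ ^ 2 * formC τ := by
  rw [formC, double_fricke, fricke, E2_S_smul, E2_S_smul, coe_double, formC]
  ring

lemma formD_fricke (τ : ℍ) : formD (fricke τ) = τ ^ 4 / 16 * formB τ := by
  have h0 := ne_zero τ
  have h1 := eta_ne_zero (double τ)
  rw [coe_double] at h1
  rw [formD, double_fricke, fricke, show 16 = 8 * 2 from rfl, pow_mul, eta_S_smul_pow,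
    eta_S_smul_pow, formB, coe_double]
  field_simp
  norm_num

lemma formB_fricke (τ : ℍ) : formB (fricke τ) = 256 * τ ^ 4 * formD τ := by
  have h0 := ne_zero τ
  have h1 := eta_ne_zero τ
  rw [formB, double_fricke, fricke, show 16 = 8 * 2 from rfl, pow_mul, eta_S_smul_pow,
    eta_S_smul_pow, formD, coe_double]
  field_simp
  ring

lemma hasQDeriv_coe : HasQDeriv (fun τ ↦ (τ : ℂ)) fun _ ↦ (2 * π * Complex.I)⁻¹ := by
  intro τ
  rw [mul_inv_cancel₀ two_pi_I_ne_zero]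
  refine (hasDerivAt_id (τ : ℂ)).congr_of_eventuallyEq ?_
  filter_upwards [isOpen_upperHalfPlaneSet.mem_nhds τ.im_pos] with z hz
  simp [ofComplex_apply_of_im_pos hz]

lemma HasQDeriv.comp_fricke {f f' : ℍ → ℂ} (hf : HasQDeriv f f') :
    HasQDeriv (fun τ ↦ f (fricke τ)) fun τ ↦ f' (fricke τ) / (2 * τ ^ 2) := by
  intro τ
  have h0 := ne_zero τ
  have hw : HasDerivAt (fun z : ℂ ↦ -(2 * z)⁻¹) (1 / (2 * (τ : ℂ) ^ 2)) τ := by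
    convert! (((hasDerivAt_id (τ : ℂ)).const_mul 2).inv (by simpa using h0)).neg using 1
    simp
    field_simp
  have hf' := hf (fricke τ)
  rw [coe_fricke] at hf'
  refine ((hf'.comp (τ : ℂ) hw).congr_deriv (by ring)).congr_of_eventuallyEq ?_
  filter_upwards [isOpen_upperHalfPlaneSet.mem_nhds τ.im_pos] with z hz
  simp only [Function.comp_apply, ofComplex_apply_of_im_pos hz]
  rw [← ofComplex_apply (fricke ⟨z, hz⟩), coe_fricke]

/-- Obtained by differentiating `E2A_fricke`; the non-modular terms are those that cancel in 8E' -
E². -/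
lemma qderiv_E2A_fricke (τ : ℍ) : qderiv E2A (fricke τ) =
    4 * τ ^ 4 * qderiv E2A τ + 4 * τ ^ 3 * E2A τ / (π * Complex.I) +
      8 * τ ^ 2 / (π * Complex.I) ^ 2 := by
  have h1 := (hasQDeriv_qderiv mdifferentiable_E2A).comp_fricke
  have h2 := (((hasQDeriv_coe.pow 2).const_mul 2).mul (hasQDeriv_qderiv mdifferentiable_E2A)).add
    (hasQDeriv_coe.const_mul (8 / (π * Complex.I)))
  have h3 : (fun τ ↦ E2A (fricke τ)) =
      fun τ : ℍ ↦ 2 * (τ : ℂ) ^ 2 * E2A τ + 8 / (π * Complex.I) * τ := by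
    ext τ
    rw [E2A_fricke]
    ring
  rw [h3] at h1
  have h := congrFun (h1.qderiv_eq.symm.trans h2.qderiv_eq) τ
  have h0 := ne_zero τ
  have hpi : (π : ℂ) ≠ 0 := by simp [Real.pi_ne_zero]
  have hI := Complex.I_ne_zero
  rw [div_eq_iff (by simpa using h0)] at h
  rw [h]
  field_simp
  push_cast
  ring

lemma qderiv_formC_fricke (τ : ℍ) : qderiv formC (fricke τ) =
    -4 * τ ^ 4 * qderiv formC τ - 4 * τ ^ 3 * formC τ / (π * Complex.I) := by
  have h1 := (hasQDeriv_qderiv mdifferentiable_formC).comp_fricke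
  have h2 := ((hasQDeriv_coe.pow 2).const_mul (-2)).mul (hasQDeriv_qderiv mdifferentiable_formC)
  rw [funext formC_fricke] at h1
  have h := congrFun (h1.qderiv_eq.symm.trans h2.qderiv_eq) τ
  have h0 := ne_zero τ
  have hpi : (π : ℂ) ≠ 0 := by simp [Real.pi_ne_zero]
  have hI := Complex.I_ne_zero
  rw [div_eq_iff (by simpa using h0)] at h
  rw [h]
  field_simp
  push_cast
  ring

/-! ### Identities in weight four -/

/-- A form of weight `4` on `Γ₀(2)` that is an eigenvector of the Fricke involution and vanishes
to order at least two at `i∞` is zero. -/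
lemma eq_zero_of_weight_four {F : ℍ → ℂ} {g : ℂ → ℂ} (hg : DifferentiableOn ℂ g (ball 0 1))
    (hF : ∀ τ, F τ = g (𝕢 1 τ)) (hg0 : g 0 = 0) (hg1 : HasDerivAt g 0 0) {c : ℂ}
    (hc : ∀ τ : ℍ, F (fricke τ) = c * τ ^ 4 * F τ) (τ : ℍ) : F τ = 0 := by
  have h0 : ball (0 : ℂ) 1 ∈ 𝓝 0 := ball_mem_nhds 0 one_pos
  -- φ is F/D: both numerator and denominator have been divided by q, and φ(0) = g'(0) = 0.
  have hφ : DifferentiableOn ℂ (fun q ↦ dslope g 0 q / formDDisc q) (ball 0 1) :=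
    ((Complex.differentiableOn_dslope h0).mpr hg).div differentiableOn_formDDisc
      fun _ ↦ formDDisc_ne_zero
  -- Since S τ is the Fricke image of τ/2, F/D becomes 16c·F/B at τ/2, and B has no zero at q = 0.
  have hψ : DifferentiableOn ℂ (fun q ↦ 16 * c * (g q / formBDisc q)) (ball 0 1) :=
    (hg.div differentiableOn_formBDisc fun _ ↦ formBDisc_ne_zero).const_mul _
  have hquot (τ : ℍ) : dslope g 0 (𝕢 1 τ) / formDDisc (𝕢 1 τ) = F τ / formD τ := by
    have hq := Periodic.qParam_ne_zero (h := 1) (τ : ℂ)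
    rw [dslope_of_ne _ hq, slope_def_field, hg0, hF, formD_eq]
    have := formDDisc_ne_zero (qParam_mem_ball one_pos τ)
    field_simp
    simp
  have h := eq_zero_of_levelTwo_weight_zero hφ hψ (by simp [hg1.deriv]) (fun τ ↦ ?_) τ
  · rw [hquot, div_eq_zero_iff] at h
    exact h.resolve_right (formD_ne_zero τ)
  · have h1 := formB_ne_zero (half τ)
    have h2 := ne_zero (half τ)
    rw [hquot, ← fricke_half, hc, formD_fricke, ← qParam_half, ← hF, ← formB_eq]
    field_simp

lemma hasDerivAt_id_mul_deriv_zero {g : ℂ → ℂ} (hg : DifferentiableOn ℂ g (ball 0 1)) {a : ℂ}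
    (h : HasDerivAt g a 0) : HasDerivAt (fun q ↦ q * deriv g q) a 0 := by
  have h' := (differentiableAt_of_mem_ball (hg.deriv isOpen_ball)
    (mem_ball_self one_pos)).hasDerivAt
  convert! (hasDerivAt_id (0 : ℂ)).mul h' using 1
  simp [h.deriv]

lemma differentiableOn_id_mul_deriv {g : ℂ → ℂ} (hg : DifferentiableOn ℂ g (ball 0 1)) :
    DifferentiableOn ℂ (fun q ↦ q * deriv g q) (ball 0 1) :=
  differentiableOn_id.mul (hg.deriv isOpen_ball)

lemma hasDerivAt_formD_zero : HasDerivAt (fun q ↦ q * formDDisc q) 1 0 := by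
  have h := (differentiableAt_of_mem_ball differentiableOn_formDDisc
    (mem_ball_self one_pos)).hasDerivAt
  convert! (hasDerivAt_id (0 : ℂ)).mul h using 1
  simp [formDDisc_zero]

lemma qderiv_E2A (τ : ℍ) : qderiv E2A τ = (E2A τ ^ 2 - formC τ ^ 2) / 8 := by
  have h := eq_zero_of_weight_four (F := fun τ ↦ 8 * qderiv E2A τ - E2A τ ^ 2 + formC τ ^ 2)
    (g := fun q ↦ 8 * (q * deriv e2ADisc q) - e2ADisc q ^ 2 + formCDisc q ^ 2) (c := 4)
    ((((differentiableOn_id_mul_deriv differentiableOn_e2ADisc).const_mul 8).sub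
      (differentiableOn_e2ADisc.pow 2)).add (differentiableOn_formCDisc.pow 2))
    (fun τ ↦ by rw [qderiv_E2A_eq, E2A_eq, formC_eq])
    (by simp [e2ADisc_zero, formCDisc_zero])
    (by
      convert! (((hasDerivAt_id_mul_deriv_zero
        differentiableOn_e2ADisc hasDerivAt_e2ADisc_zero).const_mul 8).sub (hasDerivAt_e2ADisc_zero.pow 2)).add
        (hasDerivAt_formCDisc_zero.pow 2) using 1
      norm_num [e2ADisc_zero, formCDisc_zero])
    (fun τ ↦ by
      rw [qderiv_E2A_fricke, E2A_fricke, formC_fricke]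
      ring) τ
  linear_combination h / 8

lemma formC_sq (τ : ℍ) : formC τ ^ 2 = formB τ + 64 * formD τ := by
  have h := eq_zero_of_weight_four (F := fun τ ↦ formC τ ^ 2 - formB τ - 64 * formD τ)
    (g := fun q ↦ formCDisc q ^ 2 - formBDisc q - 64 * (q * formDDisc q)) (c := 4)
    (((differentiableOn_formCDisc.pow 2).sub differentiableOn_formBDisc).sub
      ((differentiableOn_id.mul differentiableOn_formDDisc).const_mul 64))
    (fun τ ↦ by rw [formD_eq, formB_eq, formC_eq])
    (by simp [formBDisc_zero, formCDisc_zero])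
    (by
      convert! ((hasDerivAt_formCDisc_zero.pow 2).sub hasDerivAt_formBDisc_zero).sub
        (hasDerivAt_formD_zero.const_mul 64) using 1
      norm_num [formCDisc_zero])
    (fun τ ↦ by
      rw [formC_fricke, formB_fricke, formD_fricke]
      ring) τ
  linear_combination h

lemma qderiv_formC (τ : ℍ) : qderiv formC τ = (E2A τ * formC τ - formG τ) / 4 := by
  have h := eq_zero_of_weight_four
    (F := fun τ ↦ 4 * qderiv formC τ - E2A τ * formC τ + formB τ - 64 * formD τ)
    (g := fun q ↦ 4 * (q * deriv formCDisc q) - e2ADisc q * formCDisc q + formBDisc q -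
      64 * (q * formDDisc q)) (c := -4)
    (((((differentiableOn_id_mul_deriv differentiableOn_formCDisc).const_mul 4).sub
      (differentiableOn_e2ADisc.mul differentiableOn_formCDisc)).add
      differentiableOn_formBDisc).sub
      ((differentiableOn_id.mul differentiableOn_formDDisc).const_mul 64))
    (fun τ ↦ by rw [qderiv_formC_eq, E2A_eq, formC_eq, formD_eq, formB_eq])
    (by simp [e2ADisc_zero, formCDisc_zero, formBDisc_zero])
    (by
      convert! ((((hasDerivAt_id_mul_deriv_zero
        differentiableOn_formCDisc hasDerivAt_formCDisc_zero).const_mul 4).sub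
        (hasDerivAt_e2ADisc_zero.mul hasDerivAt_formCDisc_zero)).add
        hasDerivAt_formBDisc_zero).sub (hasDerivAt_formD_zero.const_mul 64) using 1
      norm_num [e2ADisc_zero, formCDisc_zero])
    (fun τ ↦ by
      rw [qderiv_formC_fricke, E2A_fricke, formC_fricke, formB_fricke, formD_fricke]
      ring) τ
  rw [formG, formC_sq]
  linear_combination h / 4

/-! ### The differential ring of the forms `E_{2A}`, `C`, `G` -/

lemma hasQDeriv_E2A : HasQDeriv E2A fun τ ↦ (E2A τ ^ 2 - formC τ ^ 2) / 8 :=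
  (hasQDeriv_qderiv mdifferentiable_E2A).congr qderiv_E2A

lemma hasQDeriv_formC : HasQDeriv formC fun τ ↦ (E2A τ * formC τ - formG τ) / 4 :=
  (hasQDeriv_qderiv mdifferentiable_formC).congr qderiv_formC

lemma hasQDeriv_formG : HasQDeriv formG fun τ ↦ (E2A τ * formG τ - formC τ ^ 3) / 2 := by
  refine ((hasQDeriv_formC.pow 2).sub (hasQDeriv_formD.const_mul 128)).congr fun τ ↦ ?_
  rw [formG]
  push_cast
  ring

lemma Delta2A_eq_mul (τ : ℍ) : Delta2A τ = formD τ * (formC τ ^ 2 - 64 * formD τ) := by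
  rw [Delta2A_eq, formC_sq]
  ring

lemma formG_sq (τ : ℍ) : formG τ ^ 2 = formC τ ^ 4 - 256 * Delta2A τ := by
  rw [Delta2A_eq_mul, formG]
  ring

lemma Delta2A_ne_zero (τ : ℍ) : Delta2A τ ≠ 0 :=
  mul_ne_zero (pow_ne_zero _ (eta_ne_zero _)) (pow_ne_zero _ (eta_ne_zero _))

/-- `f` solves the differential equation `(#)_κ`, and `f'` is its derivative. -/
structure SolvesWith (κ : ℂ) (f f' : ℍ → ℂ) : Prop where
  hasQDeriv : HasQDeriv f f'
  hasQDeriv_deriv : HasQDeriv f' fun τ ↦ (κ + 1) / 4 * E2A τ * f' τ -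
    κ * (κ + 1) / 64 * (E2A τ ^ 2 - formC τ ^ 2) * f τ

lemma SolvesWith.isSolution {k : ℕ} {f f' : ℍ → ℂ} (h : SolvesWith k f f') : IsSolution k f := by
  refine ⟨h.hasQDeriv.mdifferentiable, fun τ ↦ ?_⟩
  rw [h.hasQDeriv.qderiv_eq, h.hasQDeriv_deriv.qderiv_eq, qderiv_E2A]
  ring

/-- The operator raising solutions of `(#)_κ` to solutions of `(#)_{κ+4}`. -/
def raise (κ : ℂ) (f f' : ℍ → ℂ) (τ : ℍ) : ℂ :=
  (κ + 2) * (formG τ * f τ) + κ * (formC τ * (E2A τ * f τ)) - 8 * (formC τ * f' τ)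

/-- The derivative of `raise κ f f'`. -/
def raiseDeriv (κ : ℂ) (f f' : ℍ → ℂ) (τ : ℍ) : ℂ :=
  (κ + 4) / 8 * (E2A τ * raise κ f f' τ) + (κ + 4) * (formG τ * f' τ) -
    κ * (κ + 4) / 8 * (formG τ * (E2A τ * f τ)) -
    (κ + 2) * (κ + 4) / 8 * (formC τ ^ 3 * f τ)

/-- Once f'' is eliminated by the equation, both derivatives are polynomial identities in E, C, G,
f, f', κ; the relation for G² plays no part. -/
lemma SolvesWith.raise {κ : ℂ} {f f' : ℍ → ℂ} (h : SolvesWith κ f f') :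
    SolvesWith (κ + 4) (raise κ f f') (raiseDeriv κ f f') := by
  obtain ⟨h1, h2⟩ := h
  have hr : HasQDeriv (QuasiGamma02.raise κ f f') (raiseDeriv κ f f') := by
    refine ((((hasQDeriv_formG.mul h1).const_mul (κ + 2)).add
      ((hasQDeriv_formC.mul (hasQDeriv_E2A.mul h1)).const_mul κ)).sub
      ((hasQDeriv_formC.mul h2).const_mul 8)).congr fun τ ↦ ?_
    rw [raiseDeriv, QuasiGamma02.raise]
    ring
  refine ⟨hr, ?_⟩
  refine (((((hasQDeriv_E2A.mul hr).const_mul ((κ + 4) / 8)).add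
    ((hasQDeriv_formG.mul h2).const_mul (κ + 4))).sub
    ((hasQDeriv_formG.mul (hasQDeriv_E2A.mul h1)).const_mul (κ * (κ + 4) / 8))).sub
    (((hasQDeriv_formC.pow 3).mul h1).const_mul ((κ + 2) * (κ + 4) / 8))).congr fun τ ↦ ?_
  rw [raiseDeriv, QuasiGamma02.raise]
  push_cast
  ring

/-- The terms in E and f' regroup into `raise κ f f'`, leaving (κ+2)(κ+4)(C⁴ - G²)f, where C⁴ - G² =
256Δ. -/
lemma raise_raise {κ : ℂ} (f f' : ℍ → ℂ) (τ : ℍ) :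
    raise (κ + 4) (raise κ f f') (raiseDeriv κ f f') τ =
      (2 * κ + 10) * (formG τ * raise κ f f' τ) +
        256 * (κ + 2) * (κ + 4) * (Delta2A τ * f τ) := by
  simp only [raise, raiseDeriv]
  linear_combination (-(κ + 4) * (κ + 2) * f τ) * formG_sq τ

lemma SolvesWith.const_mul {κ : ℂ} {f f' : ℍ → ℂ} (c : ℂ) (h : SolvesWith κ f f') :
    SolvesWith κ (fun τ ↦ c * f τ) (fun τ ↦ c * f' τ) :=
  ⟨h.1.const_mul c, (h.2.const_mul c).congr fun τ ↦ by ring⟩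

/-! ### The solutions as polynomials in `E₂`, `C`, `D` -/

open MvPolynomial

/-- `G` as a polynomial in `E₂`, `C`, `D`. -/
def polyG : MvPolynomial (Fin 3) ℚ := X 1 ^ 2 - C 128 * X 2

/-- `Δ_{2A}` as a polynomial in `E₂`, `C`, `D`. -/
def polyDelta : MvPolynomial (Fin 3) ℚ := X 2 * (X 1 ^ 2 - C 64 * X 2)

/-- `C' / 24` as a polynomial in `E₂`, `C`, `D`. -/
def polyBase : MvPolynomial (Fin 3) ℚ :=
  C (1 / 96) * (C (2 / 3) * (X 0 * X 1) + C (1 / 3) * X 1 ^ 2 - polyG)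

/-- The solutions as polynomials in `E₂`, `C`, `D`. -/
def solutionPoly : ℕ → MvPolynomial (Fin 3) ℚ
  | 0 => polyBase
  | 1 => polyG * polyBase - polyDelta
  | n + 2 => polyG * solutionPoly (n + 1) + C (lam (n + 1)) * (polyDelta * solutionPoly n)

lemma isWeightedHomogeneous_sub {p r : MvPolynomial (Fin 3) ℚ} {w : ℕ}
    (hp : p.IsWeightedHomogeneous ![2, 2, 4] w) (hr : r.IsWeightedHomogeneous ![2, 2, 4] w) :
    (p - r).IsWeightedHomogeneous ![2, 2, 4] w :=
  (weightedHomogeneousSubmodule ℚ ![2, 2, 4] w).sub_mem hp hr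

lemma isWeightedHomogeneous_solutionPoly :
    ∀ n, (solutionPoly n).IsWeightedHomogeneous ![2, 2, 4] (4 * n + 4) := by
  have h0 : (X 0 : MvPolynomial (Fin 3) ℚ).IsWeightedHomogeneous ![2, 2, 4] 2 :=
    isWeightedHomogeneous_X _ _ 0
  have h1 : (X 1 : MvPolynomial (Fin 3) ℚ).IsWeightedHomogeneous ![2, 2, 4] 2 :=
    isWeightedHomogeneous_X _ _ 1
  have h2 : (X 2 : MvPolynomial (Fin 3) ℚ).IsWeightedHomogeneous ![2, 2, 4] 4 :=
    isWeightedHomogeneous_X _ _ 2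
  have h11 : (X 1 ^ 2 : MvPolynomial (Fin 3) ℚ).IsWeightedHomogeneous ![2, 2, 4] 4 := h1.pow 2
  have hG : polyG.IsWeightedHomogeneous ![2, 2, 4] 4 := isWeightedHomogeneous_sub h11 (h2.C_mul 128)
  have hD : polyDelta.IsWeightedHomogeneous ![2, 2, 4] 8 := h2.mul (isWeightedHomogeneous_sub h11 (h2.C_mul 64))
  have hB : polyBase.IsWeightedHomogeneous ![2, 2, 4] 4 :=
    (isWeightedHomogeneous_sub (((h0.mul h1).C_mul _).add (h11.C_mul _)) hG).C_mul _
  intro n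
  induction n using Nat.twoStepInduction with
  | zero => exact hB
  | one => exact isWeightedHomogeneous_sub (hG.mul hB) hD
  | more n ih ih' =>
    have e1 : 4 * (n + 2) + 4 = 4 + (4 * (n + 1) + 4) := by ring
    have e2 : 4 * (n + 2) + 4 = 8 + (4 * n + 4) := by ring
    exact (e1 ▸ hG.mul ih').add ((e2 ▸ hD.mul ih).C_mul _)

/-- The value at `(E₂, C, D)` of the `n`-th solution polynomial. -/
def solution (n : ℕ) (τ : ℍ) : ℂ := aeval ![E2 τ, formC τ, formD τ] (solutionPoly n)

lemma aeval_polyG (τ : ℍ) : aeval ![E2 τ, formC τ, formD τ] polyG = formG τ := by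
  simp [polyG, formG]

lemma aeval_polyDelta (τ : ℍ) : aeval ![E2 τ, formC τ, formD τ] polyDelta = Delta2A τ := by
  simp [polyDelta, Delta2A_eq_mul]

lemma solution_zero (τ : ℍ) : solution 0 τ = (E2A τ * formC τ - formG τ) / 96 := by
  -- This is where the coefficients 2/3 and 1/3 in `polyBase` come from.
  have h : E2A τ = (2 * E2 τ + formC τ) / 3 := by
    rw [E2A, formC]
    ring
  simp only [solution, solutionPoly, polyBase, map_mul, map_sub, map_add, aeval_polyG, h]
  simp
  ring

lemma solution_one (τ : ℍ) : solution 1 τ = formG τ * solution 0 τ - Delta2A τ := by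
  simp [solution, solutionPoly, aeval_polyG, aeval_polyDelta]

lemma solution_add_two (n : ℕ) (τ : ℍ) : solution (n + 2) τ =
    formG τ * solution (n + 1) τ + lam (n + 1) * (Delta2A τ * solution n τ) := by
  simp [solution, solutionPoly, aeval_polyG, aeval_polyDelta]

/-- After multiplication by the powers of s, both recursions involve s only through s² = Δ_{2A}. The
shift to sⁿ⁺¹ in front of Q_n gives the initial terms 0 and -Δ_{2A}. -/
lemma solutionForm_eq {s : ℍ → ℂ} (hs : ∀ τ, s τ ^ 2 = Delta2A τ) (n : ℕ) (τ : ℍ) :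
    solutionForm s n τ = solution n τ := by
  have h0 : s τ ≠ 0 := fun h ↦ Delta2A_ne_zero τ (by rw [← hs, h]; simp)
  induction n using Nat.twoStepInduction with
  | zero =>
    rw [solution_zero, solutionForm, qderiv_formC]
    simp [P, Q]
    ring
  | one =>
    rw [solution_one, solution_zero, solutionForm, qderiv_formC, ← hs]
    simp [P, Q]
    field_simp
    ring
  | more n ih ih' =>
    rw [solution_add_two, ← ih, ← ih', ← hs, solutionForm, solutionForm, solutionForm, P, Q]
    simp only [map_add, map_mul, Polynomial.aeval_X, Polynomial.aeval_C, eq_ratCast]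
    field_simp
    ring

/-! ### Contiguity: each solution is raised from the previous one. -/

lemma solvesWith_solution_zero :
    SolvesWith 3 (solution 0)
      fun τ ↦ (E2A τ ^ 2 * formC τ + formC τ ^ 3 - 2 * (E2A τ * formG τ)) / 256 := by
  rw [funext solution_zero]
  have h := ((hasQDeriv_E2A.mul hasQDeriv_formC).sub hasQDeriv_formG).const_mul (1 / 96)
  have h' := ((((hasQDeriv_E2A.pow 2).mul hasQDeriv_formC).add (hasQDeriv_formC.pow 3)).sub
      ((hasQDeriv_E2A.mul hasQDeriv_formG).const_mul 2)).const_mul (1 / 256)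
  constructor
  · convert h using 2 <;> ring
  · convert h' using 2 <;> push_cast <;> ring

/-- The solutions, together with the contiguity relation between successive ones. -/
lemma exists_solvesWith_solution (n : ℕ) : ∃ f' : ℍ → ℂ,
    SolvesWith (4 * n + 3) (solution n) f' ∧
      ∀ τ, (8 * n + 8) * solution (n + 1) τ = raise (4 * n + 3) (solution n) f' τ := by
  induction n with
  | zero =>
    refine ⟨_, by simpa using solvesWith_solution_zero, fun τ ↦ ?_⟩
    rw [solution_one, raise, solution_zero]
    push_cast
    -- R_3 f_0 = 8G f_0 + (G² - C⁴)/32, whose last term is -8Δ: this is the origin of the Q-part.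
    linear_combination (-1 / 32) * formG_sq τ
  | succ n ih =>
    obtain ⟨f', hf, hn⟩ := ih
    have hn0 : (8 * n + 8 : ℂ) ≠ 0 := by exact_mod_cast (by positivity : 8 * n + 8 ≠ 0)
    have h := hf.raise.const_mul (8 * n + 8 : ℂ)⁻¹
    have hsol : (fun τ ↦ (8 * n + 8 : ℂ)⁻¹ * raise (4 * n + 3) (solution n) f' τ) =
        solution (n + 1) := by
      ext τ
      rw [← hn, inv_mul_cancel_left₀ hn0]
    have hk : (4 * n + 3 + 4 : ℂ) = 4 * (n + 1 : ℕ) + 3 := by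
      push_cast
      ring
    rw [hsol, hk] at h
    refine ⟨_, h, fun τ ↦ ?_⟩
    -- Linearity of the raising operator moves the factor 1/(8n+8) outside, so that `raise_raise`
    -- applies.
    have hlin : raise (4 * (n + 1 : ℕ) + 3) (solution (n + 1))
        (fun τ ↦ (8 * n + 8 : ℂ)⁻¹ * raiseDeriv (4 * n + 3) (solution n) f' τ) τ =
        (8 * n + 8 : ℂ)⁻¹ * raise (4 * n + 3 + 4) (raise (4 * n + 3) (solution n) f')
          (raiseDeriv (4 * n + 3) (solution n) f') τ := by
      rw [← hsol, hk]
      simp only [raise]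
      ring
    have h1 : (n + 1 : ℂ) ≠ 0 := by exact_mod_cast n.succ_ne_zero
    have h2 : (n + 1 + 1 : ℂ) ≠ 0 := by exact_mod_cast (n + 1).succ_ne_zero
    -- With κ = 4n+3, 2κ+10 = 8(n+2) and 256(4n+5)(4n+7)/(8(n+1)) = 8(n+2)λ_{n+1}.
    rw [hlin, raise_raise, ← hn, solution_add_two, lam]
    push_cast
    field_simp
    ring

/-! ### Homogeneity, rationality and membership in the ring. -/

theorem isHomogeneousIn_solution (n : ℕ) : IsHomogeneousIn ℚ (4 * n + 4) (solution n) :=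
  ⟨solutionPoly n, isWeightedHomogeneous_solutionPoly n, fun _ ↦ rfl⟩

lemma IsHomogeneousIn.isQuasimodularForm {w : ℕ} {f : ℍ → ℂ} (h : IsHomogeneousIn ℚ w f) :
    IsQuasimodularForm w f := by
  obtain ⟨p, hp, hf⟩ := h
  refine ⟨p.map (algebraMap ℚ ℂ), fun d hd ↦ hp fun h0 ↦ hd ?_, fun τ ↦ ?_⟩
  · rw [coeff_map, h0, map_zero]
  · rw [hf, aeval_map_algebraMap]

lemma IsHomogeneousIn.mem_adjoin {w : ℕ} {f : ℍ → ℂ} (h : IsHomogeneousIn ℚ w f) :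
    f ∈ Algebra.adjoin ℚ {E2, formC, formD} := by
  obtain ⟨p, -, hf⟩ := h
  have hp : f = aeval ![E2, formC, formD] p := by
    ext τ
    rw [hf, ← Pi.evalAlgHom_apply ℚ (fun _ : ℍ ↦ ℂ) τ (aeval ![E2, formC, formD] p),
      comp_aeval_apply]
    congr 2
    ext i
    fin_cases i <;> rfl
  have hr : Set.range ![E2, formC, formD] = {E2, formC, formD} := by
    simp only [Matrix.range_cons, Matrix.range_empty, Set.union_empty, Set.singleton_union]
  rw [hp, ← hr, Algebra.adjoin_range_eq_range_aeval]
  exact ⟨p, rfl⟩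

end QuasiGamma02

end

theorem mainTheorem1 (n k : ℕ) (hk : k = 4 * n + 3)
    (s : UpperHalfPlane → ℂ) (hs : ∀ τ, s τ ^ 2 = QuasiGamma02.Delta2A τ) :
    QuasiGamma02.IsQuasimodularForm (k + 1) (QuasiGamma02.solutionForm s n) ∧
    QuasiGamma02.IsHomogeneousIn ℚ (k + 1) (QuasiGamma02.solutionForm s n) ∧
    QuasiGamma02.solutionForm s n ∈
      Algebra.adjoin ℚ {QuasiGamma02.E2, QuasiGamma02.formC, QuasiGamma02.formD} ∧
    QuasiGamma02.IsSolution k (QuasiGamma02.solutionForm s n) := by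
  subst hk
  rw [funext (QuasiGamma02.solutionForm_eq hs n)]
  have h := QuasiGamma02.isHomogeneousIn_solution n
  obtain ⟨f', hf, -⟩ := QuasiGamma02.exists_solvesWith_solution n
  refine ⟨h.isQuasimodularForm, h, h.mem_adjoin, QuasiGamma02.SolvesWith.isSolution (f' := f') ?_⟩
  exact_mod_cast hf
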